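/- Let $X$ be a connected (non-empty) simplicial complex. Write $v\sim w$ if $\{v,w\}$ is a simplex of $X$ ($v=w$ allowed), let $d$ be the path metric of the $1$-skeleton on the vertices, and for a vertex $O$ and $i\in\mathbb N$ let $B_i(O)$ and $S_i(O)$ be the full subcomplexes of $X$ spanned by the vertices at distance at most $i$, respectively exactly $i$, from $O$. The link $X_\sigma$ of a simplex $\sigma$ consists of the simplices that are disjoint from $\sigma$ and together with $\sigma$ span a simplex of $X$. Assume: 1. $X$ is uniformly locally finite: there is $N\in\mathbb N$ such that every vertex lies in at most $N$ simplices. 2. $X$ is $8$-located: it is flag (every finite non-empty set of pairwise adjacent vertices spans a simplex), and every loop (simple closed edge path of length at least $3$) of length at most $8$ that is full as a subcomplex of $X$ and homotopically trivial in $X$ is contained in $B_1(c)$ for some vertex $c$. 3. $X$ satisfies the property $SD'$: for every vertex $O$ and every $i\geq 1$, (T) for every edge $e$ of $S_{i+1}(O)$ the intersection $X_e\cap B_i(O)$ is non-empty; (V) for every vertex $v\in S_{i+1}(O)$ and all vertices $u,w\in X_v\cap B_i(O)$ there is a vertex $t\in X_v\cap B_i(O)$ with $t\sim u$ and $t\sim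 w$. Let $G$ be a group acting properly discontinuously on $X$ by simplicial automorphisms. Then $G$ satisfies condition (C): for all $g,h\in G$ with $h$ of infinite order and all $k,l\in\mathbb Z$, $$g h^k g^{-1}=h^l \implies |k|=|l|.$$ -/

import Mathlib

/-! ### Simplicial complexes: 1-skeleton, balls, spheres, links, full cycles -/

namespace AbstractSimplicialComplex

variable {V : Type*} (X : AbstractSimplicialComplex V)

open Classical in
/-- `v ∼ w`: the set `{v, w}` is a simplex of `X` (the case `v = w` is allowed). -/
def Sim (v w : V) : Prop := ({v, w} : Finset V) ∈ X.faces

open Classical in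
/-- The 1-skeleton of `X`, as a graph: distinct vertices are adjacent when they span an edge. -/
def skeleton : SimpleGraph V where
  Adj v w := v ≠ w ∧ X.Sim v w
  symm := ⟨fun v w h => ⟨h.1.symm, by
    have h2 := h.2
    unfold Sim at h2 ⊢
    rwa [Finset.pair_comm]⟩⟩
  loopless := ⟨fun _ h => h.1 rfl⟩

/-- Vertices of the ball `B_i(O)`, for the combinatorial distance (the path metric of the
1-skeleton). The ball is the full subcomplex on these vertices, so a simplex of `X` lies in it
exactly when all its vertices do. -/
def ball (O : V) (i : ℕ) : Set V := {w | X.skeleton.edist O w ≤ i}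

/-- Vertices of the sphere `S_i(O)`, again a full subcomplex. -/
def sphere (O : V) (i : ℕ) : Set V := {w | X.skeleton.edist O w = i}

open Classical in
/-- The simplices of the link `X_σ`: the simplices that are disjoint from `σ` and span a simplex
of `X` together with `σ`. -/
def link (σ : Finset V) : Set (Finset V) :=
  {τ | τ ∈ X.faces ∧ Disjoint τ σ ∧ τ ∪ σ ∈ X.faces}

/-- `X` is flag: a finite nonempty set of pairwise adjacent vertices spans a simplex. -/
def IsFlag : Prop :=
  ∀ s : Finset V, s.Nonempty → (∀ v ∈ s, ∀ w ∈ s, v ≠ w → X.skeleton.Adj v w) → s ∈ X.faces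

open Classical in
/-- A cycle in the 1-skeleton is full (as a subcomplex) if each simplex of `X` all of whose
vertices lie on the cycle is a vertex or an edge of the cycle. -/
def IsFullCycle {v : V} (p : X.skeleton.Walk v v) : Prop :=
  p.IsCycle ∧ ∀ s ∈ X.faces, (∀ u ∈ s, u ∈ p.support) →
    (∃ u, s = {u}) ∨ ∃ u w, s(u, w) ∈ p.edges ∧ s = {u, w}

open Classical in
/-- Homotopy of edge paths with fixed end points: the congruence generated by deleting a
backtracking `(u, v, u)` and by replacing two sides of a 2-simplex by the third one. -/
inductive Homotopic : ∀ {u v : V}, X.skeleton.Walk u v → X.skeleton.Walk u v → Prop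
  | refl {u v : V} (p : X.skeleton.Walk u v) : Homotopic p p
  | symm {u v : V} {p q : X.skeleton.Walk u v} : Homotopic p q → Homotopic q p
  | trans {u v : V} {p q r : X.skeleton.Walk u v} :
      Homotopic p q → Homotopic q r → Homotopic p r
  | append {u v w : V} {p p' : X.skeleton.Walk u v} {q q' : X.skeleton.Walk v w} :
      Homotopic p p' → Homotopic q q' → Homotopic (p.append q) (p'.append q')
  | backtrack {u v : V} (h : X.skeleton.Adj u v) (h' : X.skeleton.Adj v u) :
      Homotopic (.cons h (.cons h' .nil)) .nil
  | triangle {u v w : V} (huv : X.skeleton.Adj u v) (hvw : X.skeleton.Adj v w)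
      (huw : X.skeleton.Adj u w) (hface : ({u, v, w} : Finset V) ∈ X.faces) :
      Homotopic (.cons huv (.cons hvw .nil)) (.cons huw .nil)

/-- A loop is homotopically trivial if it is homotopic to a constant loop. -/
def IsNullHomotopic {v : V} (p : X.skeleton.Walk v v) : Prop := X.Homotopic p .nil

/-- `X` is `m`-located: it is flag and every full homotopically trivial loop of length at most `m`
is contained in a ball of radius 1. -/
def IsLocated (m : ℕ) : Prop :=
  X.IsFlag ∧ ∀ (v : V) (p : X.skeleton.Walk v v),
    X.IsFullCycle p → X.IsNullHomotopic p → p.length ≤ m →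
      ∃ c : V, ∀ w ∈ p.support, w ∈ X.ball c 1

open Classical in
/-- The triangle condition (T) at level `i`: for every edge `e` of `S_{i+1}(O)` the intersection of
the link `X_e` with `B_i(O)` is nonempty. -/
def TriangleCondition (O : V) (i : ℕ) : Prop :=
  ∀ a b : V, X.skeleton.Adj a b → a ∈ X.sphere O (i + 1) → b ∈ X.sphere O (i + 1) →
    ∃ τ ∈ X.link {a, b}, ∀ t ∈ τ, t ∈ X.ball O i

/-- The vertex condition (V) at level `i`: for every vertex `v` of `S_{i+1}(O)` and all vertices
`u, w` of `X_v ∩ B_i(O)` there is a vertex `t` of `X_v ∩ B_i(O)` with `t ∼ u` and `t ∼ w`. -/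
def VertexCondition (O : V) (i : ℕ) : Prop :=
  ∀ v ∈ X.sphere O (i + 1), ∀ u w : V,
    {u} ∈ X.link {v} → u ∈ X.ball O i → {w} ∈ X.link {v} → w ∈ X.ball O i →
      ∃ t : V, {t} ∈ X.link {v} ∧ t ∈ X.ball O i ∧ X.Sim t u ∧ X.Sim t w

/-- The property `SD'_n(O)`. -/
def SDAt (O : V) (n : ℕ) : Prop :=
  ∀ i : ℕ, 1 ≤ i → i ≤ n → X.TriangleCondition O i ∧ X.VertexCondition O i

/-- The property `SD'`: `SD'_n(O)` holds for each `n` and each vertex `O`. -/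
def SD : Prop := ∀ (O : V) (n : ℕ), X.SDAt O n

/-- `X` is connected (in particular nonempty). -/
def IsConnected : Prop := X.skeleton.Connected

/-- `X` is uniformly locally finite: a uniform bound on the number of simplices at a vertex. -/
def UniformlyLocallyFinite : Prop :=
  ∃ N : ℕ, ∀ v : V, {s : Finset V | s ∈ X.faces ∧ v ∈ s}.encard ≤ N

/-- An action of `G` on the vertices of `X` is simplicial (an action on `X` by automorphisms) if
each group element maps simplices to simplices. -/
def IsSimplicialAction (G : Type*) [Group G] [MulAction G V] : Prop :=
  ∀ (g : G), ∀ s ∈ X.faces, s.map (MulAction.toPerm g).toEmbedding ∈ X.faces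

end AbstractSimplicialComplex

/-! ### Groups -/

/-- Proper discontinuity of a simplicial action, in terms of the action on the vertex set `V`:
for every finite set `K` of vertices only finitely many `g` satisfy `gK ∩ K ≠ ∅`. A compact subset
of a simplicial complex lies in a finite subcomplex `L`, and `gL` meets `L` if and only if `gL` and
`L` have a vertex in common, so this is the usual condition on compact subsets. -/
def IsProperlyDiscontinuousOnVertices (G V : Type*) [Group G] [MulAction G V] : Prop :=
  ∀ K : Finset V, {g : G | ∃ v ∈ K, g • v ∈ K}.Finite

/-- Condition (C): if `h` has infinite order and `g h^k g⁻¹ = h^l`, then `|k| = |l|`. -/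
def ConditionC (G : Type*) [Group G] : Prop :=
  ∀ g h : G, ¬ IsOfFinOrder h → ∀ k l : ℤ, g * h ^ k * g⁻¹ = h ^ l → |k| = |l|

/-!
The displacement argument for condition (C) runs as follows. If `g * h ^ k * g⁻¹ = h ^ l` with
`|k| < |l|`, then the distance `d(x, h ^ m • x)` grows more slowly than any positive multiple of `m`.
This is excluded if the 1-skeleton has *thin intervals*: points at equal distance
from `O` on geodesics from `O` to equal or adjacent vertices are at distance at most `2`.

**Thin intervals** (`SimpleGraph.hasThinIntervals`). By (T) and (V) the complex is simply connected
(`AbstractSimplicialComplex.isNullHomotopic`), so that `8`-location applies to every chordless cycle.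
The main point is `SimpleGraph.exists_near_near_of_descent`: if `z₀`, `z₁`, `z₂` is a path in the
sphere of radius `m + 1` around `O` and `u`, `w` are lower neighbours of `z₀`, `z₂`, then `u` and `w`
are joined by a path of length at most `2` in the sphere of radius `m`. By induction on `m`: (T) and
(V) give a path of length at most `4` from `u` to `w` in their sphere, and the inductive hypothesis,
applied to the inner part of this path, gives a path of length at most `2` one level below. Closing up
through the `z`s one obtains a cycle of length at most `8`. If `u` and `w` are not equal or adjacent
it can be made chordless, since vertices whose levels differ by two are not adjacent; its centre is
adjacent to vertices on the levels `m + 1` and `m - 1`, so it lies on level `m` and is the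
middle vertex that is wanted. Geodesics descending from close vertices therefore stay close for ever.

**No distortion** (`SimpleGraph.HasThinIntervals.exists_card_powers_le`). Geodesics with ends at
distance `R` fellow-travel with a bound linear in `R`. The bound improves to a constant away from the
ends (`SimpleGraph.HasThinIntervals.exists_dist_le_of_middle`): in a long strip between two geodesics
the loss in length of passing from one to the other takes finitely many values and is monotone
in the segment of the strip used, so by a pigeonhole argument the change can be made early or
late along equally short paths, and thin intervals make the two geodesics meet up to distance `2`. Now
let `γ` be a very long geodesic from `x` to some `h ^ n • x`. If `h ^ m` moves `x` by at most `R`, then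
`h ^ m • γ` passes at distance at most `12` from a fixed middle vertex of `γ`, at a time known up to
an error linear in `R`. As `h` has infinite order its powers act freely on the vertices, and balls
of radius `12` have bounded size, so the number of such `m` is at most linear in `R`, with constants
that do not depend on `R`. A sublinear displacement would give more of them.
-/

/-! ### The conditions in terms of the 1-skeleton -/

namespace SimpleGraph

variable {V : Type*} (G : SimpleGraph V)

/-- Two vertices are near if they are equal or adjacent. -/
def Near (a b : V) : Prop := a = b ∨ G.Adj a b

/-- The condition (T) for a graph, at all base points `O` and all levels, including the degenerate
edges `a = b`. -/
def HasTriangleCondition : Prop :=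
  ∀ (O : V) (m : ℕ) (a b : V), G.dist O a = m + 1 → G.dist O b = m + 1 → G.Near a b →
    ∃ c, G.dist O c = m ∧ G.Adj c a ∧ G.Adj c b

/-- The condition (V) for a graph, at all base points `O` and all levels. -/
def HasVertexCondition : Prop :=
  ∀ (O : V) (m : ℕ) (v u w : V), G.dist O v = m + 1 → G.dist O u = m → G.dist O w = m →
    G.Adj u v → G.Adj w v → ∃ t, G.dist O t = m ∧ G.Adj t v ∧ G.Near t u ∧ G.Near t w

variable {G}

lemma Near.symm {a b : V} (h : G.Near a b) : G.Near b a := by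
  rcases h with h | h
  · exact Or.inl h.symm
  · exact Or.inr h.symm

lemma near_iff_dist_le_one (hG : G.Connected) {a b : V} : G.Near a b ↔ G.dist a b ≤ 1 := by
  constructor
  · rintro (rfl | h)
    · simp
    · exact (dist_eq_one_iff_adj.mpr h).le
  · intro h
    rcases Nat.le_one_iff_eq_zero_or_eq_one.mp h with h | h
    · exact Or.inl (hG.dist_eq_zero_iff.mp h)
    · exact Or.inr (dist_eq_one_iff_adj.mp h)

lemma Near.dist_le {a b : V} (h : G.Near a b) : G.dist a b ≤ 1 := by
  rcases h with rfl | h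
  · simp
  · exact (dist_eq_one_iff_adj.mpr h).le

/-- The last vertex but one of a shortest path. -/
lemma Connected.exists_adj_dist_eq (hG : G.Connected) {O a : V} {m : ℕ}
    (h : G.dist O a = m + 1) : ∃ c, G.dist O c = m ∧ G.Adj c a := by
  obtain ⟨p, hp⟩ := hG.exists_walk_length_eq_dist a O
  rw [dist_comm, h] at hp
  cases p with
  | nil => simp at hp
  | @cons _ c _ hac q =>
    refine ⟨c, ?_, hac.symm⟩
    have h1 := dist_le q
    have h2 := hG.dist_triangle (u := O) (v := c) (w := a)
    rw [dist_comm] at h1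
    rw [dist_eq_one_iff_adj.mpr hac.symm, h] at h2
    simp only [Walk.length_cons] at hp
    omega

end SimpleGraph

namespace AbstractSimplicialComplex

open SimpleGraph

variable {V : Type*} {X : AbstractSimplicialComplex V}

lemma adj_of_mem_face {s : Finset V} (hs : s ∈ X.faces) {a b : V} (ha : a ∈ s) (hb : b ∈ s)
    (hab : a ≠ b) : X.skeleton.Adj a b := by
  classical
  refine ⟨hab, ?_⟩
  have hsub : ({a, b} : Finset V) ⊆ s := by
    intro x hx
    simp only [Finset.mem_insert, Finset.mem_singleton] at hx
    rcases hx with rfl | rfl <;> assumption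
  have := (X.isRelLowerSet_faces hs).2 hsub ⟨a, by simp⟩
  unfold Sim
  convert this

open Classical in
lemma IsFlag.triangle_mem (hX : X.IsFlag) {u v w : V} (huv : X.skeleton.Adj u v)
    (hvw : X.skeleton.Adj v w) (huw : X.skeleton.Adj u w) : ({u, v, w} : Finset V) ∈ X.faces := by
  refine hX _ ⟨u, by simp⟩ ?_
  intro a ha b hb hab
  simp only [Finset.mem_insert, Finset.mem_singleton] at ha hb
  rcases ha with rfl | rfl | rfl <;> rcases hb with rfl | rfl | rfl <;>
    first | exact absurd rfl hab | assumption | (apply SimpleGraph.Adj.symm; assumption)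

open Classical in
lemma singleton_mem_link {u v : V} (h : X.skeleton.Adj u v) : {u} ∈ X.link {v} := by
  refine ⟨X.singleton_mem u, by simpa using h.1, ?_⟩
  have := h.2
  unfold Sim at this
  rwa [Finset.insert_eq] at this

open Classical in
lemma adj_of_mem_link {σ τ : Finset V} (h : τ ∈ X.link σ) {u v : V} (hu : u ∈ τ) (hv : v ∈ σ) :
    X.skeleton.Adj u v := by
  refine adj_of_mem_face h.2.2 (Finset.mem_union_left _ hu) (Finset.mem_union_right _ hv) ?_
  rintro rfl
  exact Finset.disjoint_left.mp h.2.1 hu hv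

lemma mem_ball_iff (hX : X.IsConnected) {O w : V} {i : ℕ} :
    w ∈ X.ball O i ↔ X.skeleton.dist O w ≤ i := by
  unfold ball
  rw [Set.mem_ofPred_eq, ← (hX.preconnected O w).coe_dist_eq_edist]
  exact_mod_cast Iff.rfl

lemma mem_sphere_iff (hX : X.IsConnected) {O w : V} {i : ℕ} :
    w ∈ X.sphere O i ↔ X.skeleton.dist O w = i := by
  unfold sphere
  rw [Set.mem_ofPred_eq, ← (hX.preconnected O w).coe_dist_eq_edist]
  exact_mod_cast Iff.rfl

lemma SD.hasTriangleCondition (hX : X.IsConnected) (h : X.SD) :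
    X.skeleton.HasTriangleCondition := by
  classical
  intro O m a b ha hb hab
  rcases hab with rfl | hab
  · obtain ⟨c, hc, hca⟩ := SimpleGraph.Connected.exists_adj_dist_eq hX ha
    exact ⟨c, hc, hca, hca⟩
  rcases Nat.eq_zero_or_pos m with rfl | hm
  · exact ⟨O, by simp, dist_eq_one_iff_adj.mp ha, dist_eq_one_iff_adj.mp hb⟩
  obtain ⟨τ, hτ, hball⟩ := (h O m m hm le_rfl).1 a b hab ((mem_sphere_iff hX).mpr ha)
    ((mem_sphere_iff hX).mpr hb)
  obtain ⟨t, ht⟩ := (X.isRelLowerSet_faces hτ.1).1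
  have hta := adj_of_mem_link hτ ht (v := a) (by simp)
  have htb := adj_of_mem_link hτ ht (v := b) (by simp)
  refine ⟨t, ?_, hta, htb⟩
  have h1 := (mem_ball_iff hX).mp (hball t ht)
  have h2 := SimpleGraph.Connected.dist_triangle hX (u := O) (v := t) (w := a)
  rw [dist_eq_one_iff_adj.mpr hta] at h2
  omega

lemma near_of_sim {v w : V} (h : X.Sim v w) : X.skeleton.Near v w := by
  by_cases hvw : v = w
  · exact Or.inl hvw
  · exact Or.inr ⟨hvw, h⟩

lemma SD.hasVertexCondition (hX : X.IsConnected) (h : X.SD) :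
    X.skeleton.HasVertexCondition := by
  classical
  intro O m v u w hv hu hw huv hwv
  rcases Nat.eq_zero_or_pos m with rfl | hm
  · obtain rfl := (SimpleGraph.Connected.dist_eq_zero_iff hX).mp hu
    obtain rfl := (SimpleGraph.Connected.dist_eq_zero_iff hX).mp hw
    exact ⟨_, hu, huv, Or.inl rfl, Or.inl rfl⟩
  obtain ⟨t, htv, ht, htu, htw⟩ := (h O m m hm le_rfl).2 v ((mem_sphere_iff hX).mpr hv) u w
    (by convert singleton_mem_link huv) ((mem_ball_iff hX).mpr hu.le)
    (by convert singleton_mem_link hwv) ((mem_ball_iff hX).mpr hw.le)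
  have htv' : X.skeleton.Adj t v := by
    refine adj_of_mem_link htv (by simp) (by simp)
  refine ⟨t, ?_, htv', near_of_sim htu, near_of_sim htw⟩
  have h1 := (mem_ball_iff hX).mp ht
  have h2 := SimpleGraph.Connected.dist_triangle hX (u := O) (v := t) (w := v)
  rw [dist_eq_one_iff_adj.mpr htv'] at h2
  omega

/-! ### Simple connectedness -/

/-- Two shortest walks from `O` to the same vertex are homotopic, and a shortest walk from `O`
followed by an edge is homotopic to any shortest walk with the same ends. The two statements are
proved together, by induction on the distance from `O`: two vertices just below the end of the walks
are connected by (V), and (T) provides a vertex below an edge that joins vertices of equal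
distance. -/
lemma shortest_walks_homotopic (hX : X.IsConnected) (hflag : X.IsFlag)
    (hT : X.skeleton.HasTriangleCondition) (hV : X.skeleton.HasVertexCondition) (O : V) (n : ℕ) :
    (∀ (a : V) (p q : X.skeleton.Walk O a), X.skeleton.dist O a ≤ n →
      p.length = X.skeleton.dist O a → q.length = X.skeleton.dist O a → X.Homotopic p q) ∧
    (∀ (a b : V) (hab : X.skeleton.Adj a b) (p : X.skeleton.Walk O a) (q : X.skeleton.Walk O b),
      X.skeleton.dist O a ≤ n → X.skeleton.dist O b ≤ n →
      p.length = X.skeleton.dist O a → q.length = X.skeleton.dist O b →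
      X.Homotopic (p.append (.cons hab .nil)) q) := by
  induction n with
  | zero =>
    constructor
    · intro a p q ha hp hq
      have hp0 : p.length = 0 := by omega
      have hq0 : q.length = 0 := by omega
      obtain rfl := Walk.eq_of_length_eq_zero hp0
      rw [(Walk.length_eq_zero_iff.mp hp0).eq_nil, (Walk.length_eq_zero_iff.mp hq0).eq_nil]
      exact .refl _
    · intro a b hab p q ha hb hp hq
      have h1 := (SimpleGraph.Connected.dist_eq_zero_iff hX).mp (Nat.le_zero.mp ha)
      have h2 := (SimpleGraph.Connected.dist_eq_zero_iff hX).mp (Nat.le_zero.mp hb)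
      exact absurd (h1.symm.trans h2) hab.ne
  | succ n ih =>
    obtain ⟨ihB, ihA⟩ := ih
    have last : ∀ (a : V) (p : X.skeleton.Walk O a), X.skeleton.dist O a = n + 1 →
        p.length = n + 1 → ∃ (c : V) (hca : X.skeleton.Adj c a) (p' : X.skeleton.Walk O c),
          X.skeleton.dist O c = n ∧ p'.length = n ∧ p = p'.append (.cons hca .nil) := by
      intro a p ha hp
      obtain ⟨c, p', hca, hpc⟩ : ∃ (c : V) (p' : X.skeleton.Walk O c) (hca : X.skeleton.Adj c a),
          p = p'.concat hca := by
        cases p with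
        | nil => simp at hp
        | cons h q =>
          obtain ⟨x, q', h', e⟩ := Walk.exists_cons_eq_concat h q
          exact ⟨x, q', h', e⟩
      have hl : p'.length = n := by
        have := congrArg Walk.length hpc
        simp only [Walk.length_concat] at this
        omega
      refine ⟨c, hca, p', ?_, hl, by rw [hpc, Walk.concat_eq_append]⟩
      have h1 := dist_le p'
      have h2 := SimpleGraph.Connected.dist_triangle hX (u := O) (v := c) (w := a)
      rw [dist_eq_one_iff_adj.mpr hca] at h2
      omega
    have shortcut : ∀ {c t a : V} (hca : X.skeleton.Adj c a) (hta : X.skeleton.Adj t a)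
        (_ : X.skeleton.Near t c) (p : X.skeleton.Walk O c) (r : X.skeleton.Walk O t),
        X.skeleton.dist O c = n → X.skeleton.dist O t = n → p.length = n → r.length = n →
        X.Homotopic (p.append (.cons hca .nil)) (r.append (.cons hta .nil)) := by
      intro c t a hca hta htc p r hc ht hp hr
      rcases htc with rfl | htc
      · exact .append (ihB _ p r hc.le (by omega) (by omega)) (.refl _)
      · have h1 : X.Homotopic (.cons hca .nil) (.cons htc.symm (.cons hta .nil)) :=
          .symm (.triangle htc.symm hta hca (hflag.triangle_mem htc.symm hta hca))
        have h2 := ihA c t htc.symm p r hc.le ht.le (by omega) (by omega)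
        have h3 : X.Homotopic (p.append (.cons hca .nil))
            ((p.append (.cons htc.symm .nil)).append (.cons hta .nil)) := by
          rw [← Walk.append_assoc]
          exact .append (.refl _) h1
        exact h3.trans (.append h2 (.refl _))
    have hB : ∀ (a : V) (p q : X.skeleton.Walk O a), X.skeleton.dist O a = n + 1 →
        p.length = n + 1 → q.length = n + 1 → X.Homotopic p q := by
      intro a p q ha hp hq
      obtain ⟨c, hca, p', hc, hp', rfl⟩ := last a p ha hp
      obtain ⟨d, hda, q', hd, hq', rfl⟩ := last a q ha hq
      obtain ⟨t, ht, hta, htc, htd⟩ := hV O n a c d ha hc hd hca hda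
      obtain ⟨r, hr⟩ := SimpleGraph.Connected.exists_walk_length_eq_dist hX O t
      rw [ht] at hr
      exact (shortcut hca hta htc p' r hc ht hp' hr).trans
        (shortcut hda hta htd q' r hd ht hq' hr).symm
    have hB' : ∀ (a : V) (p q : X.skeleton.Walk O a), X.skeleton.dist O a ≤ n + 1 →
        p.length = X.skeleton.dist O a → q.length = X.skeleton.dist O a → X.Homotopic p q := by
      intro a p q ha hp hq
      rcases Nat.le_or_eq_of_le_succ ha with h | h
      · exact ihB a p q h hp hq
      · exact hB a p q h (hp.trans h) (hq.trans h)
    refine ⟨hB', ?_⟩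
    intro a b hab p q ha hb hp hq
    have hd := SimpleGraph.Adj.diff_dist_adj (u := O) hab
    rcases Nat.lt_trichotomy (X.skeleton.dist O a) (X.skeleton.dist O b) with h | h | h
    · have hb' : X.skeleton.dist O b = X.skeleton.dist O a + 1 := by omega
      exact hB' b _ q hb (by simp [hp, hb']) hq
    · rcases Nat.le_or_eq_of_le_succ ha with h' | h'
      · exact ihA a b hab p q h' (h ▸ h') hp hq
      obtain ⟨t, ht, hta, htb⟩ := hT O n a b h' (h ▸ h') (Or.inr hab)
      obtain ⟨r, hr⟩ := SimpleGraph.Connected.exists_walk_length_eq_dist hX O t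
      have h1 : X.Homotopic p (r.append (.cons hta .nil)) :=
        hB a _ _ h' (hp.trans h') (by simp [hr, ht])
      have h2 : X.Homotopic q (r.append (.cons htb .nil)) :=
        hB b _ _ (h ▸ h') (hq.trans (h ▸ h')) (by simp [hr, ht])
      have h3 : X.Homotopic ((r.append (.cons hta .nil)).append (.cons hab .nil))
          (r.append (.cons htb .nil)) := by
        rw [← Walk.append_assoc]
        exact .append (.refl _) (.triangle hta hab htb (hflag.triangle_mem hta hab htb))
      exact ((Homotopic.append h1 (.refl _)).trans h3).trans h2.symm
    · have ha' : X.skeleton.dist O a = X.skeleton.dist O b + 1 := by omega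
      have h1 : X.Homotopic p (q.append (.cons hab.symm .nil)) :=
        hB' a _ _ ha hp (by simp [hq, ha'])
      have h2 : X.Homotopic ((q.append (.cons hab.symm .nil)).append (.cons hab .nil))
          (q.append .nil) := by
        rw [← Walk.append_assoc]
        exact .append (.refl _) (.backtrack hab.symm hab)
      rw [Walk.append_nil] at h2
      exact (Homotopic.append h1 (.refl _)).trans h2

/-- A flag complex with the conditions (T) and (V) is simply connected. -/
lemma isNullHomotopic (hX : X.IsConnected) (hflag : X.IsFlag)
    (hT : X.skeleton.HasTriangleCondition) (hV : X.skeleton.HasVertexCondition) {O : V}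
    (p : X.skeleton.Walk O O) : X.IsNullHomotopic p := by
  have key : ∀ (n : ℕ) (a : V) (p q : X.skeleton.Walk O a), p.length = n →
      q.length = X.skeleton.dist O a → X.Homotopic p q := by
    intro n
    induction n with
    | zero =>
      intro a p q hp hq
      obtain rfl := Walk.eq_of_length_eq_zero hp
      rw [(Walk.length_eq_zero_iff.mp hp).eq_nil,
        (Walk.length_eq_zero_iff.mp (hq.trans dist_self)).eq_nil]
      exact .refl _
    | succ n ih =>
      intro b p q hp hq
      obtain ⟨a, p', hab, hpc⟩ : ∃ (a : V) (p' : X.skeleton.Walk O a) (hab : X.skeleton.Adj a b),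
          p = p'.concat hab := by
        cases p with
        | nil => simp at hp
        | cons h q =>
          obtain ⟨x, q', h', e⟩ := Walk.exists_cons_eq_concat h q
          exact ⟨x, q', h', e⟩
      obtain ⟨r, hr⟩ := SimpleGraph.Connected.exists_walk_length_eq_dist hX O a
      have hl : p'.length = n := by
        have := congrArg Walk.length hpc
        simp only [Walk.length_concat] at this
        omega
      rw [hpc, Walk.concat_eq_append]
      exact (Homotopic.append (ih a p' r hl hr) (.refl _)).trans
        ((shortest_walks_homotopic hX hflag hT hV O
          (max (X.skeleton.dist O a) (X.skeleton.dist O b))).2 a b hab r q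
            (le_max_left _ _) (le_max_right _ _) hr hq)
  exact key _ O p .nil rfl (by simp)

/-! ### Chordless cycles -/

/-- The condition on a graph that corresponds to `8`-location: each chordless cycle of length at
most `8` that is not a triangle has a vertex at distance at most `1` from all its vertices. -/
def _root_.SimpleGraph.HasCenters (G : SimpleGraph V) : Prop :=
  ∀ (v : V) (p : G.Walk v v), p.IsCycle → p.length ≤ 8 → p.IsChordless →
    (∀ a ∈ p.support, ∀ b ∈ p.support, ∀ c ∈ p.support, G.Adj a b → G.Adj a c → ¬ G.Adj b c) →
    ∃ c, ∀ w ∈ p.support, G.dist c w ≤ 1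

lemma IsLocated.hasCenters (hX : X.IsConnected) (hloc : X.IsLocated 8) (hSD : X.SD) :
    X.skeleton.HasCenters := by
  classical
  intro v p hp hlen hchord hfree
  have hnull := isNullHomotopic hX hloc.1 (hSD.hasTriangleCondition hX)
    (hSD.hasVertexCondition hX) p
  have hfull : X.IsFullCycle p := by
    refine ⟨hp, fun s hs hsp => ?_⟩
    have hpos : 0 < s.card := Finset.card_pos.mpr (X.isRelLowerSet_faces hs).1
    have hcard : s.card ≤ 2 := by
      by_contra hcon
      obtain ⟨a, b, c, ha, hb, hc, hab, hac, hbc⟩ := Finset.two_lt_card_iff.mp (not_le.mp hcon)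
      exact hfree a (hsp a ha) b (hsp b hb) c (hsp c hc) (adj_of_mem_face hs ha hb hab)
        (adj_of_mem_face hs ha hc hac) (adj_of_mem_face hs hb hc hbc)
    obtain h | h : s.card = 1 ∨ s.card = 2 := by omega
    · exact Or.inl (Finset.card_eq_one.mp h)
    · obtain ⟨a, b, hab, rfl⟩ := Finset.card_eq_two.mp h
      refine Or.inr ⟨a, b, ?_, by congr!⟩
      exact hchord.mem_edges (hsp a (by simp)) (hsp b (by simp))
        (adj_of_mem_face hs (by simp) (by simp) hab)
  obtain ⟨c, hc⟩ := hloc.2 v p hfull hnull hlen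
  exact ⟨c, fun w hw => (mem_ball_iff hX).mp (hc w hw)⟩

end AbstractSimplicialComplex

/-! ### Descending geodesics stay close -/

namespace SimpleGraph

variable {V : Type*} {G : SimpleGraph V}

/-- Inside any set of vertices, a walk can be replaced by one that is induced, by taking one of
minimal length. -/
lemma Walk.exists_isPath_isChordless {u w : V} (A : Set V) (p₀ : G.Walk u w)
    (hA : ∀ x ∈ p₀.support, x ∈ A) :
    ∃ p : G.Walk u w, p.IsPath ∧ p.IsChordless ∧ p.length ≤ p₀.length ∧
      (∀ x ∈ p.support, x ∈ A) ∧
      ∀ a ∈ p.support, ∀ b ∈ p.support, ∀ c ∈ p.support,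
        G.Adj a b → G.Adj a c → ¬ G.Adj b c := by
  classical
  have hex : ∃ n : ℕ, ∃ p : G.Walk u w, (∀ x ∈ p.support, x ∈ A) ∧ p.length = n :=
    ⟨_, p₀, hA, rfl⟩
  obtain ⟨p₁, hp₁A, hp₁⟩ := Nat.find_spec hex
  have hmin : ∀ p : G.Walk u w, (∀ x ∈ p.support, x ∈ A) → p₁.length ≤ p.length :=
    fun p hp => hp₁ ▸ Nat.find_min' hex ⟨p, hp, rfl⟩
  obtain ⟨p, hpath, hpA, hpmin⟩ : ∃ p : G.Walk u w, p.IsPath ∧ (∀ x ∈ p.support, x ∈ A) ∧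
      ∀ q : G.Walk u w, (∀ x ∈ q.support, x ∈ A) → p.length ≤ q.length :=
    ⟨p₁.bypass, p₁.bypass_isPath, fun x hx => hp₁A x (p₁.support_bypass_subset_support hx),
      fun q hq => p₁.length_bypass_le_length.trans (hmin q hq)⟩
  have hchord : ∀ i j, i < j → j ≤ p.length → G.Adj (p.getVert i) (p.getVert j) → j = i + 1 := by
    intro i j hij hj hadj
    by_contra hne
    have h1 := hpmin ((p.take i).append (.cons hadj (p.drop j))) (by
      intro x hx
      rw [Walk.mem_support_append_iff, Walk.support_cons, List.mem_cons] at hx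
      apply hpA
      rcases hx with hx | rfl | hx
      · exact (p.isSubwalk_take i).support_subset hx
      · exact p.getVert_mem_support i
      · exact (p.isSubwalk_drop j).support_subset hx)
    simp only [Walk.length_append, Walk.length_cons, Walk.take_length, Walk.drop_length] at h1
    omega
  have hadj : ∀ i j, i ≤ p.length → j ≤ p.length → G.Adj (p.getVert i) (p.getVert j) →
      j = i + 1 ∨ i = j + 1 := by
    intro i j hi hj h
    rcases Nat.lt_trichotomy i j with hij | rfl | hij
    · exact Or.inl (hchord i j hij hj h)
    · exact absurd rfl h.ne
    · exact Or.inr (hchord j i hij hi h.symm)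
  refine ⟨p, hpath, ?_, hpmin p₀ hA, hpA, ?_⟩
  · rw [Walk.isChordless_iff_forall_mem_edges]
    intro a b ha hb hab
    obtain ⟨i, rfl, hi⟩ := Walk.mem_support_iff_exists_getVert.mp ha
    obtain ⟨j, rfl, hj⟩ := Walk.mem_support_iff_exists_getVert.mp hb
    rw [Walk.mk_mem_edges_iff_exists]
    rcases hadj i j hi hj hab with rfl | rfl
    · exact ⟨i, by grind⟩
    · exact ⟨j, by grind⟩
  · intro a ha b hb c hc hab hac hbc
    obtain ⟨i, rfl, hi⟩ := Walk.mem_support_iff_exists_getVert.mp ha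
    obtain ⟨j, rfl, hj⟩ := Walk.mem_support_iff_exists_getVert.mp hb
    obtain ⟨k, rfl, hk⟩ := Walk.mem_support_iff_exists_getVert.mp hc
    have h1 := hadj i j hi hj hab
    have h2 := hadj i k hi hk hac
    have h3 := hadj j k hj hk hbc
    omega

lemma Near.exists_walk {a b : V} (h : G.Near a b) :
    ∃ p : G.Walk a b, p.length ≤ 1 ∧ ∀ x ∈ p.support, x = a ∨ x = b := by
  rcases h with rfl | h
  · exact ⟨.nil, by simp, by simp⟩
  · exact ⟨.cons h .nil, by simp, by simp⟩

lemma exists_walk_of_near {u z₀ z₁ z₂ w : V} (h₀ : G.Adj u z₀) (h₁ : G.Near z₀ z₁)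
    (h₂ : G.Near z₁ z₂) (h₃ : G.Adj z₂ w) :
    ∃ p : G.Walk u w, p.length ≤ 4 ∧
      ∀ x ∈ p.support, x = u ∨ x = w ∨ x = z₀ ∨ x = z₁ ∨ x = z₂ := by
  obtain ⟨p, hp, hp'⟩ := h₁.exists_walk
  obtain ⟨q, hq, hq'⟩ := h₂.exists_walk
  refine ⟨.cons h₀ ((p.append q).append (.cons h₃ .nil)), ?_, ?_⟩
  · simp only [Walk.length_cons, Walk.length_append, Walk.length_nil]
    omega
  · intro x hx
    simp only [Walk.support_cons, Walk.mem_support_append_iff, List.mem_cons, Walk.support_nil,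
      List.not_mem_nil, or_false] at hx
    have := hp' x
    have := hq' x
    tauto

/-- Suppose that two vertices `u`, `w` of a sphere are joined by a path of length at most `4`
through the next larger sphere and by one through the next smaller sphere. If `u` and `w` are not
near, induced paths of this kind form a chordless cycle of length at most `8`, since
vertices whose levels differ by `2` are not adjacent. Its centre is on the level of `u` and `w`. -/
lemma HasCenters.exists_near_near (hG : G.Connected) (hC : G.HasCenters) {O u w : V} {m : ℕ}
    (hu : G.dist O u = m + 1) (hw : G.dist O w = m + 1)
    (p₀ : G.Walk u w) (hp₀ : p₀.length ≤ 4)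
    (hp₀' : ∀ x ∈ p₀.support, x = u ∨ x = w ∨ G.dist O x = m + 2)
    (q₀ : G.Walk w u) (hq₀ : q₀.length ≤ 4)
    (hq₀' : ∀ x ∈ q₀.support, x = u ∨ x = w ∨ G.dist O x = m) :
    ∃ x, G.dist O x = m + 1 ∧ G.Near u x ∧ G.Near x w := by
  by_cases hnear : G.Near u w
  · exact ⟨u, hu, Or.inl rfl, hnear⟩
  have hne : u ≠ w := fun h => hnear (Or.inl h)
  have hnadj : ¬ G.Adj u w := fun h => hnear (Or.inr h)
  have hlev : ∀ a b, G.Adj a b → G.dist O b ≤ G.dist O a + 1 := by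
    intro a b hab
    have := hG.dist_triangle (u := O) (v := a) (w := b)
    rwa [dist_eq_one_iff_adj.mpr hab] at this
  obtain ⟨p, hp, hpc, hpl, hpA, hpt⟩ := Walk.exists_isPath_isChordless _ p₀ hp₀'
  obtain ⟨q, hq, hqc, hql, hqA, hqt⟩ := Walk.exists_isPath_isChordless _ q₀ hq₀'
  have hpA' : ∀ x ∈ p.support, x = u ∨ x = w ∨ G.dist O x = m + 2 := hpA
  have hqA' : ∀ x ∈ q.support, x = u ∨ x = w ∨ G.dist O x = m := hqA
  have hpn : ¬ p.Nil := Walk.not_nil_of_ne hne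
  have hqn : ¬ q.Nil := Walk.not_nil_of_ne hne.symm
  have hz := p.adj_snd hpn
  have hα := q.adj_snd hqn
  have hzs : p.snd ∈ p.support := p.getVert_mem_support 1
  have hαs : q.snd ∈ q.support := q.getVert_mem_support 1
  have hz2 : G.dist O p.snd = m + 2 := by
    rcases hpA' _ hzs with h | h | h
    · exact absurd h hz.ne'
    · exact absurd (h ▸ hz) hnadj
    · exact h
  have hα2 : G.dist O q.snd = m := by
    rcases hqA' _ hαs with h | h | h
    · exact absurd (h ▸ hα).symm hnadj
    · exact absurd h hα.ne'
    · exact h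
  have hpl2 : 1 < p.length := by
    by_contra hcon
    have h1 : p.length ≤ 1 := by omega
    have h2 : p.snd = w := p.getVert_of_length_le h1
    exact hnadj (h2 ▸ hz)
  have hcyc : (p.append q).IsCycle := by
    refine hp.isCycle_append hq ?_ (Or.inl hpl2)
    intro x hxp hxq
    have hxu : x ≠ u := by
      rintro rfl
      have := hp.support_nodup
      rw [← Walk.cons_tail_support] at this
      exact (List.nodup_cons.mp this).1 hxp
    have hxw : x ≠ w := by
      rintro rfl
      have := hq.support_nodup
      rw [← Walk.cons_tail_support] at this
      exact (List.nodup_cons.mp this).1 hxq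
    have h1 := hpA' x (List.mem_of_mem_tail hxp)
    have h2 := hqA' x (List.mem_of_mem_tail hxq)
    simp only [hxu, hxw, false_or] at h1 h2
    omega
  have hup := p.start_mem_support
  have hwp := p.end_mem_support
  have huq := q.end_mem_support
  have hwq := q.start_mem_support
  have hcases : ∀ x ∈ (p.append q).support, (x = u ∨ x = w) ∨
      (G.dist O x = m + 2 ∧ x ∈ p.support) ∨ (G.dist O x = m ∧ x ∈ q.support) := by
    intro x hx
    rw [Walk.mem_support_append_iff] at hx
    rcases hx with hx | hx
    · rcases hpA' x hx with h | h | h <;> simp [h, hx]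
    · rcases hqA' x hx with h | h | h <;> simp [h, hx]
  have hside : ∀ a ∈ (p.append q).support, ∀ b ∈ (p.append q).support,
      G.Adj a b → (a ∈ p.support ∧ b ∈ p.support) ∨ (a ∈ q.support ∧ b ∈ q.support) := by
    intro a ha b hb hab
    have h1 := hlev a b hab
    have h2 := hlev b a hab.symm
    rcases hcases a ha with (rfl | rfl) | ⟨h, h'⟩ | ⟨h, h'⟩ <;>
      rcases hcases b hb with (rfl | rfl) | ⟨k, k'⟩ | ⟨k, k'⟩ <;>
      first | omega | tauto
  have hchord : (p.append q).IsChordless := by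
    rw [Walk.isChordless_iff_forall_mem_edges]
    intro a b ha hb hab
    rw [Walk.edges_append, List.mem_append]
    rcases hside a ha b hb hab with ⟨h, h'⟩ | ⟨h, h'⟩
    · exact Or.inl (hpc.mem_edges h h' hab)
    · exact Or.inr (hqc.mem_edges h h' hab)
  have hfree : ∀ a ∈ (p.append q).support, ∀ b ∈ (p.append q).support,
      ∀ d ∈ (p.append q).support, G.Adj a b → G.Adj a d → ¬ G.Adj b d := by
    intro a ha b hb d hd hab had hbd
    have h1 := hlev a b hab
    have h2 := hlev b a hab.symm
    have h3 := hlev a d had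
    have h4 := hlev d a had.symm
    have h5 := hlev b d hbd
    have h6 := hlev d b hbd.symm
    -- a clique on the cycle lies on one of the two induced paths
    rcases hcases a ha with (rfl | rfl) | ⟨h, h'⟩ | ⟨h, h'⟩ <;>
      rcases hcases b hb with (rfl | rfl) | ⟨k, k'⟩ | ⟨k, k'⟩ <;>
      rcases hcases d hd with (rfl | rfl) | ⟨l, l'⟩ | ⟨l, l'⟩ <;>
      first
        | omega
        | exact hpt _ (by assumption) _ (by assumption) _ (by assumption) hab had hbd
        | exact hqt _ (by assumption) _ (by assumption) _ (by assumption) hab had hbd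
  obtain ⟨c, hc⟩ := hC u (p.append q) hcyc (by rw [Walk.length_append]; omega) hchord hfree
  have hcen : ∀ x ∈ (p.append q).support, G.dist O x ≤ G.dist O c + 1 ∧
      G.dist O c ≤ G.dist O x + 1 := by
    intro x hx
    have h1 := hG.dist_triangle (u := O) (v := c) (w := x)
    have h2 := hG.dist_triangle (u := O) (v := x) (w := c)
    have h3 := hc x hx
    rw [dist_comm (u := x)] at h2
    omega
  have h1 := hcen _ (Walk.support_subset_support_append_left p q hzs)
  have h2 := hcen _ (Walk.support_subset_support_append_right p q hαs)
  refine ⟨c, by omega, ?_, ?_⟩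
  · exact ((near_iff_dist_le_one hG).mpr
      (hc u (Walk.support_subset_support_append_left p q hup))).symm
  · exact (near_iff_dist_le_one hG).mpr (hc w (Walk.support_subset_support_append_left p q hwp))

/-- Vertices joined by a path of length at most two in a sphere have lower neighbours which are
again joined by such a path in the next smaller sphere, whatever lower neighbours are chosen. -/
lemma exists_near_near_of_descent (hG : G.Connected) (hT : G.HasTriangleCondition)
    (hV : G.HasVertexCondition) (hC : G.HasCenters) (O : V) (m : ℕ) :
    ∀ z₀ z₁ z₂ u w : V, G.dist O z₀ = m + 1 → G.dist O z₁ = m + 1 → G.dist O z₂ = m + 1 →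
      G.Near z₀ z₁ → G.Near z₁ z₂ → G.Adj u z₀ → G.Adj w z₂ → G.dist O u = m → G.dist O w = m →
      ∃ x, G.dist O x = m ∧ G.Near u x ∧ G.Near x w := by
  induction m with
  | zero =>
    intro z₀ z₁ z₂ u w _ _ _ _ _ _ _ hu hw
    obtain rfl := hG.dist_eq_zero_iff.mp hu
    obtain rfl := hG.dist_eq_zero_iff.mp hw
    exact ⟨_, hu, Or.inl rfl, Or.inl rfl⟩
  | succ m ih =>
    intro z₀ z₁ z₂ u w hz₀ hz₁ hz₂ h₀₁ h₁₂ hu hw hul hwl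
    -- Given a path of length at most `4` from `u` to `w` in their sphere, the inductive hypothesis
    -- shortens the parallel path one level below, and the cycle formed with `z₀`, `z₁`, `z₂`
    -- has length at most `8`.
    have close : ∀ z₀ z₁ z₂ u w s c s' : V, G.dist O z₀ = m + 2 → G.dist O z₁ = m + 2 →
        G.dist O z₂ = m + 2 → G.Near z₀ z₁ → G.Near z₁ z₂ → G.Adj u z₀ → G.Adj w z₂ →
        G.dist O u = m + 1 → G.dist O w = m + 1 → G.dist O s = m + 1 → G.dist O c = m + 1 →
        G.dist O s' = m + 1 → G.Near u s → G.Near s c → G.Near c s' → G.Near s' w →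
        ∃ x, G.dist O x = m + 1 ∧ G.Near u x ∧ G.Near x w := by
      intro z₀ z₁ z₂ u w s c s' hz₀ hz₁ hz₂ h₀₁ h₁₂ hu hw hul hwl hs hc hs' hus hsc hcs' hsw
      obtain ⟨a, ha, hau, has⟩ := hT O m u s hul hs hus
      obtain ⟨b, hb, hbs, hbw⟩ := hT O m s' w hs' hwl hsw
      obtain ⟨y, hy, hay, hyb⟩ := ih s c s' a b hs hc hs' hsc hcs' has hbs ha hb
      obtain ⟨p, hp, hp'⟩ := exists_walk_of_near hu h₀₁ h₁₂ hw.symm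
      obtain ⟨q, hq, hq'⟩ := exists_walk_of_near hbw.symm hyb.symm hay.symm hau
      refine hC.exists_near_near hG hul hwl p hp ?_ q hq ?_
      · intro x hx
        rcases hp' x hx with rfl | rfl | rfl | rfl | rfl <;> simp [*]
      · intro x hx
        rcases hq' x hx with rfl | rfl | rfl | rfl | rfl <;> simp [*]
    have edge : ∀ z z' u w : V, G.dist O z = m + 2 → G.dist O z' = m + 2 → G.Near z z' →
        G.Adj u z → G.Adj w z' → G.dist O u = m + 1 → G.dist O w = m + 1 →
        ∃ x, G.dist O x = m + 1 ∧ G.Near u x ∧ G.Near x w := by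
      intro z z' u w hz hz' hzz' hu hw hul hwl
      obtain ⟨c, hc, hcz, hcz'⟩ := hT O (m + 1) z z' hz hz' hzz'
      obtain ⟨s, hs, _, hsu, hsc⟩ := hV O (m + 1) z u c hz hul hc hu hcz
      obtain ⟨s', hs', _, hs'c, hs'w⟩ := hV O (m + 1) z' c w hz' hc hwl hcz' hw
      exact close z z z' u w s c s' hz hz hz' (Or.inl rfl) hzz' hu hw hul hwl hs hc hs' hsu.symm
        hsc hs'c.symm hs'w
    obtain ⟨c, hc, hcz₁, hcz₂⟩ := hT O (m + 1) z₁ z₂ hz₁ hz₂ h₁₂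
    obtain ⟨s, hs, hus, hsc⟩ := edge z₀ z₁ u c hz₀ hz₁ h₀₁ hu hcz₁ hul hc
    obtain ⟨s', hs', hcs', hs'w⟩ := edge z₂ z₂ c w hz₂ hz₂ (Or.inl rfl) hcz₂ hw hc hwl
    exact close z₀ z₁ z₂ u w s c s' hz₀ hz₁ hz₂ h₀₁ h₁₂ hu hw hul hwl hs hc hs' hus hsc hcs' hs'w

/-- Intervals with a common end point `O` whose other end points are equal or adjacent are uniformly
close: points at the same distance from `O` are at distance at most `2`. -/
def HasThinIntervals (G : SimpleGraph V) : Prop :=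
  ∀ O y y' p q : V, G.Near y y' → G.dist O p + G.dist p y = G.dist O y →
    G.dist O q + G.dist q y' = G.dist O y' → G.dist O p = G.dist O q → G.dist p q ≤ 2

lemma hasThinIntervals (hG : G.Connected) (hT : G.HasTriangleCondition)
    (hV : G.HasVertexCondition) (hC : G.HasCenters) : G.HasThinIntervals := by
  have descend : ∀ (O : V) (i k : ℕ) (y x y' p q : V), G.dist O y = i + k → G.dist O x = i + k →
      G.dist O y' = i + k → G.Near y x → G.Near x y' → G.dist O p = i → G.dist O q = i →
      G.dist p y = k → G.dist q y' = k → G.dist p q ≤ 2 := by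
    intro O i k
    induction k with
    | zero =>
      intro y x y' p q _ _ _ hyx hxy' _ _ hpy hqy
      obtain rfl := hG.dist_eq_zero_iff.mp hpy
      obtain rfl := hG.dist_eq_zero_iff.mp hqy
      have := hG.dist_triangle (u := p) (v := x) (w := q)
      have := hyx.dist_le
      have := hxy'.dist_le
      omega
    | succ k ih =>
      intro y x y' p q hy hx hy' hyx hxy' hp hq hpy hqy
      have pred : ∀ p y : V, G.dist O p = i → G.dist O y = i + (k + 1) → G.dist p y = k + 1 →
          ∃ z, G.dist p z = k ∧ G.Adj z y ∧ G.dist O z = i + k := by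
        intro p y hp hy hpy
        obtain ⟨z, hz, hzy⟩ := hG.exists_adj_dist_eq hpy
        have h1 := hG.dist_triangle (u := O) (v := p) (w := z)
        have h2 := hG.dist_triangle (u := O) (v := z) (w := y)
        rw [dist_eq_one_iff_adj.mpr hzy] at h2
        exact ⟨z, hz, hzy, by omega⟩
      obtain ⟨z, hpz, hzy, hz⟩ := pred p y hp hy hpy
      obtain ⟨z', hqz, hzy', hz'⟩ := pred q y' hq hy' hqy
      obtain ⟨t, ht, hzt, htz⟩ := exists_near_near_of_descent hG hT hV hC O (i + k) y x y' z z'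
        hy hx hy' hyx hxy' hzy hzy' hz hz'
      exact ih z t z' p q hz ht hz' hzt htz hp hq hpz hqz
  -- If the end points are on different levels, both points lie on intervals to the farther one.
  have lower : ∀ O y y' p q : V, G.Near y y' → G.dist O p + G.dist p y = G.dist O y →
      G.dist O q + G.dist q y' = G.dist O y' → G.dist O p = G.dist O q →
      G.dist O y' = G.dist O y + 1 → G.dist p q ≤ 2 := by
    intro O y y' p q hyy' hp hq hpq h
    have h1 := hG.dist_triangle (u := p) (v := y) (w := y')
    have h2 := hyy'.dist_le
    have h3 := hG.dist_triangle (u := O) (v := p) (w := y')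
    exact descend O (G.dist O p) (G.dist p y') y' y' y' p q (by omega) (by omega) (by omega)
      (Or.inl rfl) (Or.inl rfl) rfl hpq.symm rfl (by omega)
  intro O y y' p q hyy' hp hq hpq
  have h1 := hG.dist_triangle (u := O) (v := y) (w := y')
  have h2 := hG.dist_triangle (u := O) (v := y') (w := y)
  have h3 := hyy'.dist_le
  have h4 := hyy'.symm.dist_le
  rcases Nat.lt_trichotomy (G.dist O y) (G.dist O y') with h | h | h
  · exact lower O y y' p q hyy' hp hq hpq (by omega)
  · exact descend O (G.dist O p) (G.dist p y) y y y' p q (by omega) (by omega) (by omega)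
      (Or.inl rfl) hyy' rfl hpq.symm rfl (by omega)
  · rw [dist_comm]
    exact lower O y' y q p hyy'.symm hq hp hpq.symm (by omega)

end SimpleGraph

/-! ### Fellow traveling and long strips -/

namespace SimpleGraph

variable {V : Type*} {G : SimpleGraph V}

/-- The restriction of `γ` to `{0, …, L}` is a geodesic. -/
def IsGeodesic (G : SimpleGraph V) (γ : ℕ → V) (L : ℕ) : Prop :=
  ∀ i j, i ≤ j → j ≤ L → G.dist (γ i) (γ j) = j - i

lemma IsGeodesic.dist_le {γ : ℕ → V} {L : ℕ} (h : G.IsGeodesic γ L) {i j d : ℕ} (hi : i ≤ L)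
    (hj : j ≤ L) (hd : G.dist (γ i) (γ j) ≤ d) : i ≤ j + d ∧ j ≤ i + d := by
  rcases le_total i j with hij | hij
  · have := h i j hij hj
    omega
  · have := h j i hij hi
    rw [dist_comm] at this
    omega

lemma IsGeodesic.shift {γ : ℕ → V} {L : ℕ} (h : G.IsGeodesic γ L) {a K : ℕ} (ha : a + K ≤ L) :
    G.IsGeodesic (fun k => γ (a + k)) K := by
  intro i j hij hj
  have := h (a + i) (a + j) (by omega) (by omega)
  simp only [this]
  omega

lemma Connected.exists_isGeodesic (hG : G.Connected) (x y : V) :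
    ∃ γ : ℕ → V, γ 0 = x ∧ γ (G.dist x y) = y ∧ G.IsGeodesic γ (G.dist x y) := by
  obtain ⟨p, hp⟩ := hG.exists_walk_length_eq_dist x y
  refine ⟨p.getVert, p.getVert_zero, hp ▸ p.getVert_length, ?_⟩
  have hle : ∀ i k, i + k ≤ p.length → G.dist (p.getVert i) (p.getVert (i + k)) ≤ k := by
    intro i k
    induction k with
    | zero => simp
    | succ k ih =>
      intro hk
      have h1 := ih (by omega)
      have h2 := p.adj_getVert_succ (i := i + k) (by omega)
      have h3 := hG.dist_triangle (u := p.getVert i) (v := p.getVert (i + k))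
        (w := p.getVert (i + k + 1))
      rw [dist_eq_one_iff_adj.mpr h2] at h3
      rw [← Nat.add_assoc]
      omega
  intro i j hij hj
  have h1 := hle 0 i (by omega)
  have h2 := hle i (j - i) (by omega)
  have h3 := hle j (p.length - j) (by omega)
  have e2 : i + (j - i) = j := by omega
  have e3 : j + (p.length - j) = p.length := by omega
  rw [e2] at h2
  rw [e3, p.getVert_length] at h3
  rw [Nat.zero_add, p.getVert_zero] at h1
  have h4 := hG.dist_triangle (u := x) (v := p.getVert i) (w := y)
  have h5 := hG.dist_triangle (u := p.getVert i) (v := p.getVert j) (w := y)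
  omega

lemma Connected.exists_mem_interval (hG : G.Connected) (O y : V) {j : ℕ} (hj : j ≤ G.dist O y) :
    ∃ p, G.dist O p = j ∧ G.dist O p + G.dist p y = G.dist O y := by
  obtain ⟨γ, h0, h1, hγ⟩ := hG.exists_isGeodesic O y
  have h2 := hγ 0 j (by omega) hj
  have h3 := hγ j _ hj le_rfl
  rw [h0] at h2
  rw [h1] at h3
  exact ⟨γ j, by omega, by omega⟩

/-- Two geodesics from `O`, run at unit speed and stopped at their ends `y` and `y'`, are at
distance at most `2 * d(y, y') + 2` at any time `i`; here `p` and `q` are their positions. -/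
lemma HasThinIntervals.fellow_travel (hG : G.Connected) (hthin : G.HasThinIntervals) (O : V)
    (i R : ℕ) : ∀ y y' p q : V, G.dist y y' = R →
      G.dist O p = min i (G.dist O y) → G.dist O p + G.dist p y = G.dist O y →
      G.dist O q = min i (G.dist O y') → G.dist O q + G.dist q y' = G.dist O y' →
      G.dist p q ≤ 2 * R + 2 := by
  induction R with
  | zero =>
    intro y y' p q hyy' hp hpy hq hqy
    obtain rfl := hG.dist_eq_zero_iff.mp hyy'
    exact hthin O y y p q (Or.inl rfl) hpy hqy (hp.trans hq.symm)
  | succ R ih =>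
    intro y y' p q hyy' hp hpy hq hqy
    rw [dist_comm] at hyy'
    obtain ⟨y₁, hy₁, hadj⟩ := hG.exists_adj_dist_eq hyy'
    obtain ⟨p₁, hp₁, hpy₁⟩ := hG.exists_mem_interval O y₁ (min_le_right i (G.dist O y₁))
    rw [dist_comm] at hy₁
    have h1 := ih y₁ y' p₁ q hy₁ hp₁ hpy₁ hq hqy
    have hone : G.dist y y₁ = 1 := dist_eq_one_iff_adj.mpr hadj.symm
    have h2 : G.dist p p₁ ≤ 2 := by
      by_cases heq : G.dist O p = G.dist O p₁
      · exact hthin O y y₁ p p₁ (Or.inr hadj.symm) hpy hpy₁ heq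
      -- otherwise both geodesics have already stopped at time `i`
      · have h3 := hG.dist_triangle (u := O) (v := y) (w := y₁)
        have h4 := hG.dist_triangle (u := O) (v := y₁) (w := y)
        rw [dist_comm (u := y₁), hone] at h4
        rw [hone] at h3
        obtain rfl := hG.dist_eq_zero_iff.mp (show G.dist p y = 0 by omega)
        obtain rfl := hG.dist_eq_zero_iff.mp (show G.dist p₁ y₁ = 0 by omega)
        omega
    have h3 := hG.dist_triangle (u := p) (v := p₁) (w := q)
    omega

/-- Geodesics whose end points are close stay close. -/
lemma HasThinIntervals.exists_dist_le (hG : G.Connected) (hthin : G.HasThinIntervals)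
    {γ γ' : ℕ → V} {L L' R : ℕ} (hγ : G.IsGeodesic γ L) (hγ' : G.IsGeodesic γ' L')
    (h₀ : G.dist (γ 0) (γ' 0) ≤ R) (h₁ : G.dist (γ L) (γ' L') ≤ R) {i : ℕ} (hi : i ≤ L) :
    ∃ j ≤ L', G.dist (γ i) (γ' j) ≤ 4 * R + 4 := by
  obtain ⟨q, hq, hqy⟩ := hG.exists_mem_interval (γ 0) (γ' L')
    (min_le_right i (G.dist (γ 0) (γ' L')))
  have a1 := hγ 0 i (by omega) hi
  have a2 := hγ i L hi le_rfl
  have a3 := hγ 0 L (by omega) le_rfl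
  have h2 := hthin.fellow_travel hG (γ 0) i _ (γ L) (γ' L') (γ i) q rfl (by omega) (by omega) hq hqy
  set t := G.dist (γ' L') q with ht
  have ht' : G.dist q (γ' L') = t := dist_comm
  have b0 : G.dist (γ' L') (γ 0) = G.dist (γ 0) (γ' L') := dist_comm
  have b1 : G.dist q (γ 0) = G.dist (γ 0) q := dist_comm
  have b2 := hγ' 0 L' (by omega) le_rfl
  rw [dist_comm] at b2
  have b3 := hγ' (L' - min t L') L' (by omega) le_rfl
  rw [dist_comm] at b3
  have b4 := hγ' 0 (L' - min t L') (by omega) (by omega)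
  rw [dist_comm] at b4
  have h3 := hthin.fellow_travel hG (γ' L') t _ (γ 0) (γ' 0) q (γ' (L' - min t L')) rfl
    (by omega) (by omega) (by omega) (by omega)
  refine ⟨L' - min t L', by omega, ?_⟩
  have h4 := hG.dist_triangle (u := γ i) (v := q) (w := γ' (L' - min t L'))
  omega

/-- Two long geodesics at bounded distance come uniformly close, however large the bound is.

Let `F s t = d(γ s, γ' t) - (t - s)`, the loss in length of passing from `γ` to `γ'` between the
times `s` and `t`. It takes finitely many values and decreases if the interval `[s, t]` grows, so
some interval contains two distant subintervals on which `F` takes the same value as on the whole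
interval. Geodesics can then change from `γ` to `γ'` early or late, and the
thinness of intervals applies between the two changes. -/
lemma HasThinIntervals.exists_dist_le_two (hG : G.Connected) (hthin : G.HasThinIntervals)
    {γ γ' : ℕ → V} {L W : ℕ} (hγ : G.IsGeodesic γ L) (hγ' : G.IsGeodesic γ' L)
    (hW : ∀ i ≤ L, G.dist (γ i) (γ' i) ≤ W) {a b : ℕ} (hb : b ≤ L)
    (hab : a + 3 ^ (2 * W) * (2 * W + 1) ≤ b) :
    ∃ i j, a ≤ i ∧ i ≤ b ∧ a ≤ j ∧ j ≤ b ∧ G.dist (γ i) (γ' j) ≤ 2 := by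
  set F : ℕ → ℕ → ℤ := fun s t => (G.dist (γ s) (γ' t) : ℤ) - ((t : ℤ) - s) with hF
  have hle : ∀ s t, s ≤ t → t ≤ L → F s t ≤ W := by
    intro s t hst ht
    have h1 := hG.dist_triangle (u := γ s) (v := γ' s) (w := γ' t)
    have h2 := hγ' s t hst ht
    have h3 := hW s (by omega)
    simp only [hF]
    omega
  have hge : ∀ s t, s ≤ t → t ≤ L → -(W : ℤ) ≤ F s t := by
    intro s t hst ht
    have h1 := hG.dist_triangle (u := γ' s) (v := γ s) (w := γ' t)
    have h2 := hγ' s t hst ht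
    have h3 := hW s (by omega)
    rw [dist_comm (u := γ' s) (v := γ s)] at h1
    simp only [hF]
    omega
  have hmono : ∀ s s' t' t, s ≤ s' → s' ≤ t' → t' ≤ t → t ≤ L → F s t ≤ F s' t' := by
    intro s s' t' t h1 h2 h3 ht
    have e1 := hγ s s' h1 (by omega)
    have e2 := hγ' t' t h3 ht
    have e3 := hG.dist_triangle (u := γ s) (v := γ s') (w := γ' t)
    have e4 := hG.dist_triangle (u := γ s') (v := γ' t') (w := γ' t)
    simp only [hF]
    omega
  have key : ∀ N s t : ℕ, s + 3 ^ N * (2 * W + 1) ≤ t → t ≤ L → (W : ℤ) - N ≤ F s t →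
      ∃ s₀ t₀ s₁ t₁, s ≤ s₀ ∧ s₀ ≤ t₀ ∧ t₀ + (2 * W + 1) ≤ s₁ ∧ s₁ ≤ t₁ ∧ t₁ ≤ t ∧
        F s₀ t₀ = F s₀ t₁ ∧ F s₁ t₁ = F s₀ t₁ := by
    intro N
    induction N with
    | zero =>
      intro s t hst ht hFst
      simp only [pow_zero, one_mul] at hst
      have h1 := hmono s s s t le_rfl le_rfl (by omega) ht
      have h2 := hmono s t t t (by omega) le_rfl le_rfl ht
      have h3 := hle s s le_rfl (by omega)
      have h4 := hle t t le_rfl ht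
      have h5 := hle s t (by omega) ht
      exact ⟨s, s, t, t, le_rfl, le_rfl, hst, le_rfl, le_rfl, by omega, by omega⟩
    | succ N ih =>
      intro s t hst ht hFst
      set T := 3 ^ N * (2 * W + 1) with hT
      have hpos : 2 * W + 1 ≤ T := Nat.le_mul_of_pos_left _ (by positivity)
      have h3T : 3 ^ (N + 1) * (2 * W + 1) = 3 * T := by rw [hT]; ring
      rw [h3T] at hst
      have h1 := hmono s s (s + T) t le_rfl (by omega) (by omega) ht
      have h2 := hmono s (t - T) t t (by omega) (by omega) le_rfl ht
      push_cast at hFst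
      by_cases hl : F s (s + T) = F s t
      · by_cases hr : F (t - T) t = F s t
        · exact ⟨s, s + T, t - T, t, le_rfl, by omega, by omega, by omega, le_rfl, hl, hr⟩
        · obtain ⟨s₀, t₀, s₁, t₁, g1, g2, g3, g4, g5, g6, g7⟩ :=
            ih (t - T) t (by omega) ht (by omega)
          exact ⟨s₀, t₀, s₁, t₁, by omega, g2, g3, g4, g5, g6, g7⟩
      · obtain ⟨s₀, t₀, s₁, t₁, g1, g2, g3, g4, g5, g6, g7⟩ :=
          ih s (s + T) le_rfl (by omega) (by omega)
        exact ⟨s₀, t₀, s₁, t₁, g1, g2, g3, g4, by omega, g6, g7⟩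
  have hab' : a ≤ b := le_trans (Nat.le_add_right _ _) hab
  have hFab := hge a b hab' hb
  obtain ⟨s₀, t₀, s₁, t₁, g1, g2, g3, g4, g5, g6, g7⟩ :=
    key (2 * W) a b hab hb (by push_cast; omega)
  have hf1 := hle s₀ t₀ g2 (by omega)
  have hf2 := hge s₀ t₀ g2 (by omega)
  obtain ⟨k, hk⟩ : ∃ k : ℕ, (k : ℤ) = W - F s₀ t₀ := ⟨(W - F s₀ t₀).toNat, by omega⟩
  refine ⟨t₀ + W, t₀ + k, by omega, by omega, by omega, by omega, ?_⟩
  -- both points lie on geodesics from `γ s₀` to `γ' t₁`, at the same distance from `γ s₀`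
  have e1 := hγ s₀ (t₀ + W) (by omega) (by omega)
  have e2 := hγ (t₀ + W) s₁ (by omega) (by omega)
  have e3 := hγ' t₀ (t₀ + k) (by omega) (by omega)
  have e4 := hγ' (t₀ + k) t₁ (by omega) (by omega)
  have d1 := hG.dist_triangle (u := γ (t₀ + W)) (v := γ s₁) (w := γ' t₁)
  have d2 := hG.dist_triangle (u := γ s₀) (v := γ (t₀ + W)) (w := γ' t₁)
  have d3 := hG.dist_triangle (u := γ s₀) (v := γ' t₀) (w := γ' (t₀ + k))
  have d4 := hG.dist_triangle (u := γ s₀) (v := γ' (t₀ + k)) (w := γ' t₁)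
  simp only [hF] at g6 g7 hk
  exact hthin (γ s₀) (γ' t₁) (γ' t₁) _ _ (Or.inl rfl) (by omega) (by omega) (by omega)

/-- The distance from their ends beyond which geodesics with ends at distance at most `R` are
uniformly close. -/
def stripLength (R : ℕ) : ℕ := 3 ^ (2 * (9 * R + 8)) * (2 * (9 * R + 8) + 1)

/-- Far from their ends, geodesics of the same length whose end points are at distance at most `R`
are close, with a bound that does not depend on `R`. -/
lemma HasThinIntervals.exists_dist_le_of_middle (hG : G.Connected) (hthin : G.HasThinIntervals)
    {γ γ' : ℕ → V} {L R : ℕ} (hγ : G.IsGeodesic γ L) (hγ' : G.IsGeodesic γ' L)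
    (h₀ : G.dist (γ 0) (γ' 0) ≤ R) (h₁ : G.dist (γ L) (γ' L) ≤ R) {i : ℕ}
    (hi : stripLength R ≤ i) (hiL : i + stripLength R ≤ L) :
    ∃ j, i ≤ j + (9 * R + 20) ∧ j ≤ i + (9 * R + 20) ∧ G.dist (γ i) (γ' j) ≤ 12 := by
  have hW : ∀ i ≤ L, G.dist (γ i) (γ' i) ≤ 9 * R + 8 := by
    intro i hi
    obtain ⟨j, hj, hd⟩ := hthin.exists_dist_le hG hγ hγ' h₀ h₁ hi
    have e1 := hγ 0 i (by omega) hi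
    have e2 := hγ' 0 j (by omega) hj
    have d1 := hG.dist_triangle (u := γ 0) (v := γ' 0) (w := γ' j)
    have d2 := hG.dist_triangle (u := γ 0) (v := γ' j) (w := γ i)
    have d3 := hG.dist_triangle (u := γ' 0) (v := γ 0) (w := γ' j)
    have d4 := hG.dist_triangle (u := γ 0) (v := γ i) (w := γ' j)
    have d5 := hG.dist_triangle (u := γ i) (v := γ' j) (w := γ' i)
    rw [dist_comm (u := γ' 0) (v := γ 0)] at d3
    rw [dist_comm (u := γ' j) (v := γ i)] at d2
    rcases le_total i j with hij | hij
    · have e3 := hγ' i j hij hj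
      rw [dist_comm] at e3
      omega
    · have e3 := hγ' j i hij hi
      omega
  obtain ⟨s, s', -, hs, -, hs', hd⟩ := hthin.exists_dist_le_two hG hγ hγ' hW (a := 0)
    (b := stripLength R) (by omega) (by simp [stripLength])
  obtain ⟨t, t', ht, htL, ht', htL', hd'⟩ := hthin.exists_dist_le_two hG hγ hγ' hW
    (a := L - stripLength R) (b := L) le_rfl (by unfold stripLength at *; omega)
  have k1 := hγ.shift (a := s) (K := t - s) (by omega)
  have k2 := hγ'.shift (a := s') (K := t' - s') (by omega)
  have c1 : s + (t - s) = t := by omega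
  have c2 : s' + (t' - s') = t' := by omega
  have c3 : s + (i - s) = i := by omega
  obtain ⟨j, hj, hdj⟩ := hthin.exists_dist_le hG k1 k2 (R := 2) (by simpa using hd)
    (by simpa [c1, c2] using hd') (i := i - s) (by omega)
  simp only [c3] at hdj
  have h2 := hW i (by omega)
  have h3 := hG.dist_triangle (u := γ' i) (v := γ i) (w := γ' (s' + j))
  rw [dist_comm (u := γ' i) (v := γ i)] at h3
  obtain ⟨h4, h5⟩ := hγ'.dist_le (i := i) (j := s' + j) (d := 9 * R + 20) (by omega) (by omega)
    (by omega)
  exact ⟨s' + j, h4, h5, by omega⟩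

end SimpleGraph

/-! ### Isometries of infinite order are not distorted -/

namespace SimpleGraph

variable {V : Type*} {G : SimpleGraph V}

/-- In a graph of bounded degree, balls of a given radius have bounded size. -/
lemma Connected.exists_card_ball_le (hG : G.Connected) {N : ℕ}
    (hN : ∀ v, (G.neighborSet v).encard ≤ N) (r : ℕ) :
    ∃ B : ℕ, ∀ v, ∃ s : Finset V, s.card ≤ B ∧ ∀ w, G.dist v w ≤ r → w ∈ s := by
  classical
  induction r with
  | zero =>
    refine ⟨1, fun v => ⟨{v}, by simp, fun w hw => ?_⟩⟩
    rw [Finset.mem_singleton]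
    exact (hG.dist_eq_zero_iff.mp (Nat.le_zero.mp hw)).symm
  | succ r ih =>
    obtain ⟨B, hB⟩ := ih
    refine ⟨B + B * N, fun v => ?_⟩
    obtain ⟨s, hs, hsv⟩ := hB v
    have hfin : ∀ w, (G.neighborSet w).Finite := fun w =>
      Set.finite_of_encard_le_coe (hN w)
    refine ⟨s ∪ s.biUnion fun w => (hfin w).toFinset, ?_, fun w hw => ?_⟩
    · refine (Finset.card_union_le _ _).trans (add_le_add hs ?_)
      refine (Finset.card_biUnion_le_card_mul _ _ N fun w _ => ?_).trans
        (Nat.mul_le_mul_right _ hs)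
      have := hN w
      rw [(hfin w).encard_eq_coe_toFinset_card] at this
      exact_mod_cast this
    · rw [Finset.mem_union]
      rcases Nat.le_or_eq_of_le_succ hw with h | h
      · exact Or.inl (hsv w h)
      · obtain ⟨c, hc, hcw⟩ := hG.exists_adj_dist_eq h
        exact Or.inr (Finset.mem_biUnion.mpr ⟨c, hsv c hc.le, by simpa using hcw⟩)

end SimpleGraph

section Action

variable {G V : Type*} [Group G] [MulAction G V]

lemma IsProperlyDiscontinuousOnVertices.zpow_smul_injective
    (hproper : IsProperlyDiscontinuousOnVertices G V) {h : G} (hh : ¬ IsOfFinOrder h) (v : V) :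
    Function.Injective fun m : ℤ => h ^ m • v := by
  have hinj : Function.Injective fun m : ℤ => h ^ m := injective_zpow_iff_not_isOfFinOrder.mpr hh
  intro a b hab
  by_contra hne
  have hfix : h ^ (a - b) • v = v := by
    have : h ^ (-b) • (h ^ a • v) = h ^ (-b) • (h ^ b • v) := congrArg _ hab
    rwa [smul_smul, smul_smul, ← zpow_add, ← zpow_add, neg_add_cancel, zpow_zero, one_smul,
      neg_add_eq_sub] at this
  have hall : ∀ n : ℤ, h ^ ((a - b) * n) • v = v := by
    intro n
    rw [zpow_mul]
    exact MulAction.mem_stabilizer_iff.mp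
      (Subgroup.zpow_mem (MulAction.stabilizer G v) (MulAction.mem_stabilizer_iff.mpr hfix) n)
  refine Set.infinite_of_injective_forall_mem (f := fun n : ℤ => h ^ ((a - b) * n)) ?_ ?_
    (hproper {v})
  · intro m n hmn
    exact mul_left_cancel₀ (sub_ne_zero.mpr hne) (hinj hmn)
  · intro n
    exact ⟨v, by simp, by simp [hall n]⟩

variable {Γ : SimpleGraph V}

open SimpleGraph

/-- The number of the powers of `h` that move the vertex `x` by at most `R` grows at most linearly
in `R`: along a long geodesic `γ` from `x` to some `h ^ n • x`, all the translates `h ^ m • γ` with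
`m` in question pass uniformly close to a vertex in the middle of `γ`, at a time that is
determined up to an error linear in `R`. -/
lemma SimpleGraph.HasThinIntervals.exists_card_powers_le (hG : Γ.Connected)
    (hthin : Γ.HasThinIntervals) {N : ℕ} (hN : ∀ v, (Γ.neighborSet v).encard ≤ N)
    (hiso : ∀ (g : G) (v w : V), Γ.dist (g • v) (g • w) = Γ.dist v w) {h : G}
    (hfree : ∀ v : V, Function.Injective fun m : ℤ => h ^ m • v) (x : V) :
    ∃ C : ℕ, ∀ R M : ℕ, (∀ m ≤ M, Γ.dist x (h ^ (m : ℤ) • x) ≤ R) →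
      M + 1 ≤ (18 * R + 41) * C := by
  classical
  obtain ⟨C, hC⟩ := hG.exists_card_ball_le hN 12
  refine ⟨C, fun R M hM => ?_⟩
  obtain ⟨n, hn⟩ : ∃ n : ℤ, 2 * stripLength R ≤ Γ.dist x (h ^ n • x) := by
    by_contra! hcon
    obtain ⟨B, hB⟩ := hG.exists_card_ball_le hN (2 * stripLength R)
    obtain ⟨s, -, hs⟩ := hB x
    exact Set.infinite_of_injective_forall_mem (hfree x) (fun n => hs _ (hcon n).le)
      s.finite_toSet
  obtain ⟨γ, hγ0, hγL, hγ⟩ := hG.exists_isGeodesic x (h ^ n • x)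
  set L := Γ.dist x (h ^ n • x) with hL
  set i := stripLength R
  set D := 9 * R + 20 with hD
  choose s hs hsmem using hC
  have hmaps : ∀ m ∈ Finset.range (M + 1), h ^ (-(m : ℤ)) • γ i ∈
      (Finset.Icc (i - D) (i + D)).biUnion fun j => s (γ j) := by
    intro m hm
    have hmR := hM m (Nat.lt_succ_iff.mp (Finset.mem_range.mp hm))
    obtain ⟨j, hj₁, hj₂, hj⟩ := hthin.exists_dist_le_of_middle hG (γ := γ)
      (γ' := fun k => h ^ (m : ℤ) • γ k) (L := L) (R := R) hγ
      (fun a b hab hb => by rw [hiso]; exact hγ a b hab hb) (by rw [hγ0]; exact hmR)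
      (by
        simp only [hγL]
        rw [smul_smul, ← zpow_add, add_comm, zpow_add, mul_smul, hiso]
        exact hmR) (i := i) le_rfl (by omega)
    rw [Finset.mem_biUnion]
    refine ⟨j, Finset.mem_Icc.mpr ⟨by omega, by omega⟩, hsmem _ _ ?_⟩
    rw [dist_comm, ← hiso (h ^ (m : ℤ)), smul_smul, ← zpow_add, add_neg_cancel, zpow_zero,
      one_smul]
    exact hj
  have hcard := Finset.card_le_card_of_injOn _ hmaps (by
    intro a _ b _ hab
    have := hfree (γ i) hab
    omega)
  rw [Finset.card_range] at hcard
  refine hcard.trans ((Finset.card_biUnion_le_card_mul _ _ C fun j _ => hs _).trans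
    (Nat.mul_le_mul_right _ ?_))
  rw [Nat.card_Icc]
  omega

/-- A relation `g * h ^ k * g⁻¹ = h ^ l` with `|k| < |l|` makes the displacement of the powers of
`h` sublinear, which contradicts the linear bound on the number of powers with given
displacement. -/
lemma SimpleGraph.HasThinIntervals.natAbs_le_of_conj (hG : Γ.Connected)
    (hthin : Γ.HasThinIntervals) {N : ℕ} (hN : ∀ v, (Γ.neighborSet v).encard ≤ N)
    (hiso : ∀ (g : G) (v w : V), Γ.dist (g • v) (g • w) = Γ.dist v w)
    (hproper : IsProperlyDiscontinuousOnVertices G V) {g h : G} (hh : ¬ IsOfFinOrder h) {k l : ℤ}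
    (hrel : g * h ^ k * g⁻¹ = h ^ l) : l.natAbs ≤ k.natAbs := by
  by_contra! hkl
  obtain ⟨x⟩ := hG.nonempty
  obtain ⟨C, hC⟩ := hthin.exists_card_powers_le hG hN hiso
    (hproper.zpow_smul_injective hh) x
  -- the displacement function of the powers of `h`
  set d : ℤ → ℕ := fun m => Γ.dist x (h ^ m • x) with hd
  have hneg : ∀ m, d (-m) = d m := by
    intro m
    simp only [hd]
    rw [← hiso (h ^ m), smul_smul, ← zpow_add, add_neg_cancel, zpow_zero, one_smul, dist_comm]
  have hadd : ∀ m n, d (m + n) ≤ d m + d n := by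
    intro m n
    have := hG.dist_triangle (u := x) (v := h ^ m • x) (w := h ^ (m + n) • x)
    rw [zpow_add, mul_smul, hiso] at this
    simpa only [hd, zpow_add, mul_smul] using this
  have hmul : ∀ (a : ℕ) (m : ℤ), d (a * m) ≤ a * d m := by
    intro a m
    induction a with
    | zero => simp [hd]
    | succ a ih =>
      have := hadd (a * m) m
      push_cast
      rw [add_mul, one_mul, add_mul, one_mul]
      omega
  have hconj : ∀ j : ℕ, g ^ j * h ^ (k ^ j) * (g ^ j)⁻¹ = h ^ (l ^ j) := by
    intro j
    induction j with
    | zero => simp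
    | succ j ih =>
      calc g ^ (j + 1) * h ^ (k ^ (j + 1)) * (g ^ (j + 1))⁻¹
          = g ^ j * (g * h ^ k * g⁻¹) ^ (k ^ j) * (g ^ j)⁻¹ := by
            rw [conj_zpow, ← zpow_mul, ← pow_succ']
            group
        _ = (g ^ j * h ^ (k ^ j) * (g ^ j)⁻¹) ^ l := by
            rw [hrel, conj_zpow, ← zpow_mul, ← zpow_mul, mul_comm]
        _ = h ^ (l ^ (j + 1)) := by rw [ih, ← zpow_mul, ← pow_succ]
  set A := Γ.dist x (g • x) with hA
  have hgpow : ∀ j : ℕ, Γ.dist x (g ^ j • x) ≤ j * A := by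
    intro j
    induction j with
    | zero => simp
    | succ j ih =>
      have := hG.dist_triangle (u := x) (v := g ^ j • x) (w := g ^ (j + 1) • x)
      rw [pow_succ, mul_smul, hiso] at this
      rw [pow_succ, mul_smul, add_mul, one_mul]
      omega
  have hdabs : ∀ m : ℤ, d m = d m.natAbs := by
    intro m
    rcases Int.natAbs_eq m with h1 | h1
    · rw [← h1]
    · conv_lhs => rw [h1, hneg]
  have hdl : ∀ j : ℕ, d ((l.natAbs ^ j : ℕ) : ℤ) ≤ 2 * j * A + k.natAbs ^ j * d 1 := by
    intro j
    have h1 : d (l ^ j) ≤ j * A + d (k ^ j) + j * A := by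
      have e0 : Γ.dist x ((g ^ j)⁻¹ • x) = Γ.dist x (g ^ j • x) := by
        rw [← hiso (g ^ j), smul_inv_smul, dist_comm]
      have e1 := hG.dist_triangle (u := x) (v := g ^ j • x)
        (w := g ^ j • h ^ (k ^ j) • (g ^ j)⁻¹ • x)
      have e2 := hG.dist_triangle (u := x) (v := h ^ (k ^ j) • x)
        (w := h ^ (k ^ j) • (g ^ j)⁻¹ • x)
      rw [hiso] at e1 e2
      have e3 := hgpow j
      simp only [hd]
      rw [← hconj j, mul_smul, mul_smul]
      omega
    have h2 : d (k ^ j) ≤ k.natAbs ^ j * d 1 := by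
      rw [hdabs, Int.natAbs_pow]
      simpa using hmul (k.natAbs ^ j) 1
    rw [hdabs, Int.natAbs_pow] at h1
    calc d ((l.natAbs ^ j : ℕ) : ℤ) ≤ j * A + d (k ^ j) + j * A := h1
      _ ≤ j * A + k.natAbs ^ j * d 1 + j * A := by gcongr
      _ = 2 * j * A + k.natAbs ^ j * d 1 := by ring
  have hkpos : 0 < k.natAbs := by
    rw [Int.natAbs_pos]
    rintro rfl
    have h1 : h ^ (0 : ℤ) = h ^ l := by rw [← hrel]; simp
    have := injective_zpow_iff_not_isOfFinOrder.mpr hh h1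
    simp [← this] at hkl
  -- division with remainder by `P` bounds the displacement by a linear function of small slope
  have hlin : ∀ P : ℕ, 0 < P → P ≤ 18 * d P * C := by
    intro P hP
    by_contra! hcon
    set q := (18 * (P * d 1) + 41) * C with hq
    have h1 := hC (q * d P + P * d 1) (q * P) (by
      intro m hm
      have h2 : (m : ℤ) = ((m / P : ℕ) : ℤ) * P + ((m % P : ℕ) : ℤ) * 1 := by
        rw [mul_one]
        exact_mod_cast (Nat.div_add_mod' m P).symm
      have h3 : d m ≤ (m / P : ℕ) * d P + (m % P : ℕ) * d 1 := by
        rw [h2]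
        exact (hadd _ _).trans (add_le_add (hmul _ _) (hmul _ _))
      refine h3.trans (add_le_add (Nat.mul_le_mul_right _ ?_) (Nat.mul_le_mul_right _ ?_))
      · exact Nat.div_le_of_le_mul (by rwa [mul_comm])
      · exact (Nat.mod_lt _ hP).le)
    have h4 : (18 * (q * d P + P * d 1) + 41) * C = q * (18 * d P * C) + q := by
      rw [hq]; ring
    have h5 : q * (18 * d P * C + 1) ≤ q * P := Nat.mul_le_mul_left _ hcon
    rw [mul_add, mul_one] at h5
    omega
  have hbound : ∀ j : ℕ, l.natAbs ^ j ≤ (j + 1) * k.natAbs ^ j * (18 * (2 * A + d 1) * C) := by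
    intro j
    refine (hlin _ (pow_pos (by omega) j)).trans ?_
    have h1 : 2 * j * A + k.natAbs ^ j * d 1 ≤ (j + 1) * k.natAbs ^ j * (2 * A + d 1) := by
      have h2 : 1 ≤ k.natAbs ^ j := Nat.one_le_pow _ _ hkpos
      nlinarith [Nat.zero_le (j * d 1 * k.natAbs ^ j), Nat.zero_le (A * k.natAbs ^ j),
        Nat.mul_le_mul_left (j * A) h2]
    calc 18 * d ((l.natAbs ^ j : ℕ) : ℤ) * C
        ≤ 18 * ((j + 1) * k.natAbs ^ j * (2 * A + d 1)) * C := by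
          gcongr
          exact (hdl j).trans h1
      _ = (j + 1) * k.natAbs ^ j * (18 * (2 * A + d 1) * C) := by ring
  -- an exponential function with base `|l| / |k| > 1` is not bounded by a linear one
  set K : ℕ := 18 * (2 * A + d 1) * C with hK
  set r : ℝ := (l.natAbs : ℝ) / k.natAbs with hr
  have hk0 : (0 : ℝ) < k.natAbs := by exact_mod_cast hkpos
  have hr1 : 1 < r := by
    rw [hr, one_lt_div hk0]
    exact_mod_cast hkl
  have hrb : ∀ j : ℕ, r ^ j ≤ (j + 1) * K := by
    intro j
    rw [hr, div_pow, div_le_iff₀ (by positivity)]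
    have := hbound j
    have h2 : ((l.natAbs ^ j : ℕ) : ℝ) ≤ (((j + 1) * k.natAbs ^ j * K : ℕ) : ℝ) := by
      exact_mod_cast this
    push_cast at h2
    linarith
  have hlim := (tendsto_pow_const_div_const_pow_of_one_lt 1 hr1).add
    (tendsto_pow_const_div_const_pow_of_one_lt 0 hr1)
  have hlim' := hlim.mul_const (K : ℝ)
  rw [add_zero, zero_mul] at hlim'
  obtain ⟨j, hj⟩ := (hlim'.eventually (gt_mem_nhds zero_lt_one)).exists
  have hpos : 0 < r ^ j := by positivity
  rw [pow_one, pow_zero, ← add_div, div_mul_eq_mul_div, div_lt_one hpos] at hj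
  exact absurd hj (not_lt.mpr (hrb j))

end Action

/-! ### Actions on complexes -/

namespace AbstractSimplicialComplex

open SimpleGraph

variable {V : Type*} {X : AbstractSimplicialComplex V}

lemma UniformlyLocallyFinite.exists_encard_neighborSet_le (hX : X.UniformlyLocallyFinite) :
    ∃ N : ℕ, ∀ v, (X.skeleton.neighborSet v).encard ≤ N := by
  classical
  obtain ⟨N, hN⟩ := hX
  refine ⟨N, fun v => le_trans ?_ (hN v)⟩
  refine Set.encard_le_encard_of_injOn (f := fun w => ({v, w} : Finset V)) ?_ ?_
  · intro w hw
    have := hw.2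
    unfold Sim at this
    exact ⟨by convert this, by simp⟩
  · intro a ha b hb hab
    have h1 : a ∈ ({v, b} : Finset V) := by
      rw [← show ({v, a} : Finset V) = {v, b} from hab]
      simp
    simp only [Finset.mem_insert, Finset.mem_singleton] at h1
    rcases h1 with h1 | h1
    · exact absurd h1.symm ha.1
    · exact h1

lemma IsSimplicialAction.adj_smul {G : Type*} [Group G] [MulAction G V]
    (hX : X.IsSimplicialAction G) (g : G) {v w : V} (hvw : X.skeleton.Adj v w) :
    X.skeleton.Adj (g • v) (g • w) := by
  classical
  have h1 := hX g _ hvw.2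
  exact adj_of_mem_face h1 (Finset.mem_map.mpr ⟨v, by simp, rfl⟩)
    (Finset.mem_map.mpr ⟨w, by simp, rfl⟩) fun h => hvw.1 (MulAction.injective g h)

lemma IsSimplicialAction.dist_smul {G : Type*} [Group G] [MulAction G V]
    (hconn : X.IsConnected) (hX : X.IsSimplicialAction G) (g : G) (v w : V) :
    X.skeleton.dist (g • v) (g • w) = X.skeleton.dist v w := by
  have hle : ∀ (g : G) (v w : V), X.skeleton.dist (g • v) (g • w) ≤ X.skeleton.dist v w := by
    intro g v w
    obtain ⟨p, hp⟩ := SimpleGraph.Connected.exists_walk_length_eq_dist hconn v w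
    let f : X.skeleton →g X.skeleton := ⟨fun v => g • v, fun h => hX.adj_smul g h⟩
    calc X.skeleton.dist (g • v) (g • w) ≤ (p.map f).length := dist_le _
      _ = X.skeleton.dist v w := by rw [Walk.length_map, hp]
  refine le_antisymm (hle g v w) ?_
  simpa using hle g⁻¹ (g • v) (g • w)

end AbstractSimplicialComplex

theorem lemma4p2 {V : Type*} (X : AbstractSimplicialComplex V) (hconn : X.IsConnected)
    (hulf : X.UniformlyLocallyFinite) (hloc : X.IsLocated 8) (hSD : X.SD)
    {G : Type*} [Group G] [MulAction G V] (hsimp : X.IsSimplicialAction G)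
    (hproper : IsProperlyDiscontinuousOnVertices G V) :
    ConditionC G := by
  intro g h hh k l hrel
  obtain ⟨N, hN⟩ := hulf.exists_encard_neighborSet_le
  have hthin : X.skeleton.HasThinIntervals := SimpleGraph.hasThinIntervals hconn
    (hSD.hasTriangleCondition hconn) (hSD.hasVertexCondition hconn) (hloc.hasCenters hconn hSD)
  have hiso := hsimp.dist_smul hconn
  have hrel' : g⁻¹ * h ^ l * g⁻¹⁻¹ = h ^ k := by
    rw [← hrel]
    group
  have h1 := hthin.natAbs_le_of_conj hconn hN hiso hproper hh hrel
  have h2 := hthin.natAbs_le_of_conj hconn hN hiso hproper hh hrel'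
  rw [Int.abs_eq_natAbs, Int.abs_eq_natAbs, le_antisymm h2 h1]
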